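/- Let $V$ be a discrete valuation ring with quotient field $F$, let $K/F$ be a finite Galois extension with group $G$, and let $S$ be the integral closure of $V$ in $K$. Assume that $S$ is unramified over $V$. Let $f\colon G\times G\to K\setminus\{0\}$ be a normalized two-cocycle (that is, $f(1,\sigma)=f(\sigma,1)=1$ and $\sigma(f(\tau,\gamma))f(\sigma,\tau\gamma)=f(\sigma,\tau)f(\sigma\tau,\gamma)$ for all $\sigma,\tau,\gamma\in G$) all of whose values lie in $S$; they need not be units of $S$. Let $A_f=\sum_{\sigma\in G}Sx_\sigma$ be the associated crossed-product order in the crossed-product algebra $\Sigma_f=(K/F,G,f)=\bigoplus_{\sigma\in G}Kx_\sigma$, with multiplication given by $x_\sigma s=\sigma(s)x_\sigma$ and $x_\sigma x_\tau=f(\sigma,\tau)x_{\sigma\tau}$. For a maximal ideal $M$ of $S$, let $D_M=\{\sigma\in G:\sigma(M)=M\}$ be its decomposition group, $K_M=K^{D_M}$ its decomposition field, $S_M\subseteq K$ the localization of $S$ at $M$, and $f_M$ the restriction of $f$ to $D_M\times D_M$. Let $A_{f_M}=\sum_{\sigma\in D_M}S_Mx_\sigma$ inside $\Sigma_{f_M}=(K/K_M,D_M,f_M)=\bigoplus_{\sigma\in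 D_M}Kx_\sigma$. If the ring $A_f$ is hereditary (all its left ideals and all its right ideals are projective), then for every maximal ideal $M$ of $S$ the ring $A_{f_M}$ is a maximal order over the valuation ring $S_M\cap K_M$ in the $K_M$-algebra $\Sigma_{f_M}$: it is a subring that is finitely generated as an $(S_M\cap K_M)$-module and spans $\Sigma_{f_M}$ over $K_M$, and it is not properly contained in any other such subring of $\Sigma_{f_M}$. -/

import Mathlib

open scoped Pointwise

namespace CrossedOrder

/-- A normalized two-cocycle `f ∈ Z²(G, U(K))` for a group `G` acting on a field `K`. -/
structure NormalizedCocycle (G K : Type*) [Group G] [Field K] [MulSemiringAction G K] where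
  /-- the value `f(σ, τ)` -/
  val : G → G → K
  val_ne_zero : ∀ σ τ : G, val σ τ ≠ 0
  val_cocycle : ∀ σ τ γ : G, σ • val τ γ * val σ (τ * γ) = val σ τ * val (σ * τ) γ
  val_one_left : ∀ σ : G, val 1 σ = 1
  val_one_right : ∀ σ : G, val σ 1 = 1

/-- The restriction of a normalized two-cocycle to a subgroup. -/
def NormalizedCocycle.restrict {G K : Type*} [Group G] [Field K] [MulSemiringAction G K]
    (f : NormalizedCocycle G K) (D : Subgroup G) : NormalizedCocycle D K where
  val σ τ := f.val (σ : G) (τ : G)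
  val_ne_zero σ τ := f.val_ne_zero (σ : G) (τ : G)
  val_cocycle σ τ γ := f.val_cocycle (σ : G) (τ : G) (γ : G)
  val_one_left σ := f.val_one_left (σ : G)
  val_one_right σ := f.val_one_right (σ : G)

/-- The crossed product `Σ_f = ⊕_{σ ∈ G} K x_σ`: the element `∑ a_σ x_σ` is the finitely
supported function `σ ↦ a_σ`. -/
def CrossedProduct {G K : Type*} [Group G] [Field K] [MulSemiringAction G K]
    (_f : NormalizedCocycle G K) : Type _ :=
  G →₀ K

namespace CrossedProduct

section

variable {G K : Type*} [Group G] [Field K] [MulSemiringAction G K] {f : NormalizedCocycle G K}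

noncomputable instance instAddCommGroup : AddCommGroup (CrossedProduct f) :=
  inferInstanceAs (AddCommGroup (G →₀ K))

/-- The additive identification of `Σ_f` with the finitely supported functions `G → K`. -/
noncomputable def toFinsupp : CrossedProduct f ≃+ (G →₀ K) :=
  AddEquiv.refl (G →₀ K)

/-- The element `s x_σ`. -/
noncomputable def single (f : NormalizedCocycle G K) (σ : G) (s : K) : CrossedProduct f :=
  toFinsupp.symm (Finsupp.single σ s)

/-- The coefficient `a_σ` of `∑ a_σ x_σ`. -/
noncomputable def coeff (a : CrossedProduct f) (σ : G) : K :=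
  toFinsupp a σ

/-- The product determined by `x_σ s = σ(s) x_σ` and `x_σ x_τ = f(σ, τ) x_{στ}`, that is
`(∑ a_σ x_σ) (∑ b_τ x_τ) = ∑ a_σ σ(b_τ) f(σ, τ) x_{στ}`. -/
noncomputable instance instMul : Mul (CrossedProduct f) where
  mul a b := (toFinsupp a).sum fun σ s =>
    (toFinsupp b).sum fun τ t => single f (σ * τ) (s * σ • t * f.val σ τ)

noncomputable instance instOne : One (CrossedProduct f) where
  one := single f 1 1

theorem mul_def (a b : CrossedProduct f) :
    a * b = (toFinsupp a).sum fun σ s =>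
      (toFinsupp b).sum fun τ t => single f (σ * τ) (s * σ • t * f.val σ τ) :=
  rfl

theorem one_def : (1 : CrossedProduct f) = single f 1 1 :=
  rfl

theorem single_zero (σ : G) : single f σ 0 = 0 :=
  Finsupp.single_zero σ

theorem single_add (σ : G) (s t : K) : single f σ (s + t) = single f σ s + single f σ t :=
  Finsupp.single_add σ s t

@[elab_as_elim]
theorem induction {p : CrossedProduct f → Prop} (a : CrossedProduct f) (h0 : p 0)
    (hadd : ∀ a b, p a → p b → p (a + b)) (hs : ∀ σ s, p (single f σ s)) : p a :=
  Finsupp.induction_linear (motive := p) a h0 hadd hs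

theorem single_mul_single (σ τ : G) (s t : K) :
    single f σ s * single f τ t = single f (σ * τ) (s * σ • t * f.val σ τ) := by
  rw [mul_def]
  refine (Finsupp.sum_single_index ?_).trans (Finsupp.sum_single_index ?_)
  · simp [single_zero, Finsupp.sum]
  · simp [single_zero]

protected theorem zero_mul (a : CrossedProduct f) : 0 * a = 0 :=
  Finsupp.sum_zero_index

protected theorem mul_zero (a : CrossedProduct f) : a * 0 = 0 := by
  rw [mul_def]
  exact Finset.sum_eq_zero fun _ _ => Finsupp.sum_zero_index

protected theorem add_mul (a b c : CrossedProduct f) : (a + b) * c = a * c + b * c := by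
  refine Finsupp.sum_add_index' (fun σ => ?_) (fun σ s t => ?_)
  · simp [single_zero, Finsupp.sum]
  · simp only [_root_.add_mul, single_add]
    exact Finsupp.sum_add

protected theorem mul_add (a b c : CrossedProduct f) : a * (b + c) = a * b + a * c := by
  simp only [mul_def]
  refine Eq.trans ?_ Finsupp.sum_add
  refine Finset.sum_congr rfl fun σ _ => ?_
  refine Finsupp.sum_add_index' (fun τ => ?_) (fun τ s t => ?_)
  · simp [single_zero]
  · simp only [smul_add, _root_.add_mul, _root_.mul_add, single_add]

protected theorem mul_assoc (a b c : CrossedProduct f) : a * b * c = a * (b * c) := by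
  induction a using induction with
  | h0 => simp only [CrossedProduct.zero_mul]
  | hadd a a' ha ha' => simp only [CrossedProduct.add_mul, ha, ha']
  | hs σ s =>
    induction b using induction with
    | h0 => simp only [CrossedProduct.zero_mul, CrossedProduct.mul_zero]
    | hadd b b' hb hb' =>
      simp only [CrossedProduct.add_mul, CrossedProduct.mul_add, hb, hb']
    | hs τ t =>
      induction c using induction with
      | h0 => simp only [CrossedProduct.mul_zero]
      | hadd c c' hc hc' => simp only [CrossedProduct.mul_add, hc, hc']
      | hs γ u =>
        simp only [single_mul_single, mul_assoc, smul_mul', mul_smul]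
        congr 1
        have h := f.val_cocycle σ τ γ
        linear_combination -(s * σ • t * σ • τ • u) * h

noncomputable instance instRing : Ring (CrossedProduct f) where
  __ := instAddCommGroup
  __ := instMul
  __ := instOne
  zero_mul := CrossedProduct.zero_mul
  mul_zero := CrossedProduct.mul_zero
  left_distrib := CrossedProduct.mul_add
  right_distrib := CrossedProduct.add_mul
  mul_assoc := CrossedProduct.mul_assoc
  one_mul a := by
    induction a using induction with
    | h0 => exact CrossedProduct.mul_zero _
    | hadd a a' ha ha' => rw [CrossedProduct.mul_add, ha, ha']
    | hs σ s => simp [one_def, single_mul_single, f.val_one_left]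
  mul_one a := by
    induction a using induction with
    | h0 => exact CrossedProduct.zero_mul _
    | hadd a a' ha ha' => rw [CrossedProduct.add_mul, ha, ha']
    | hs σ s => simp [one_def, single_mul_single, f.val_one_right]

theorem coeff_single [DecidableEq G] (σ τ : G) (s : K) :
    (single f σ s).coeff τ = if σ = τ then s else 0 :=
  Finsupp.single_apply

/-- The embedding `c ↦ c x_1` of a ring of scalars on which `G` acts trivially. -/
noncomputable def scalarHom (k : Type*) [CommRing k] [Algebra k K] :
    k →+* CrossedProduct f where
  toFun c := single f 1 (algebraMap k K c)
  map_one' := by simp [one_def]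
  map_zero' := by simp [single_zero]
  map_add' c d := by simp [single_add]
  map_mul' c d := by simp [single_mul_single, f.val_one_left]

/-- `Σ_f` is an algebra over every ring of scalars that commutes with the action of `G`,
through `c ↦ c x_1`. -/
noncomputable instance instAlgebra (k : Type*) [CommRing k] [Algebra k K]
    [SMulCommClass G k K] : Algebra k (CrossedProduct f) :=
  (scalarHom k).toAlgebra' fun c a => by
    have hc : ∀ σ : G, σ • algebraMap k K c = algebraMap k K c := fun σ => by
      rw [Algebra.algebraMap_eq_smul_one, smul_comm, smul_one]
    change single f 1 (algebraMap k K c) * a = a * single f 1 (algebraMap k K c)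
    induction a using induction with
    | h0 => rw [mul_zero, zero_mul]
    | hadd a a' ha ha' => rw [mul_add, add_mul, ha, ha']
    | hs σ s =>
      simp [single_mul_single, f.val_one_left, f.val_one_right, hc, mul_comm]

end

end CrossedProduct

/-- For a subring `T` of `K` that is stable under `G` and contains the values of `f`, the subring
`∑_{σ ∈ G} T x_σ` of `Σ_f`. -/
def crossedProductOrder {G K : Type*} [Group G] [Field K] [MulSemiringAction G K]
    (f : NormalizedCocycle G K) (T : Subring K) (hT : ∀ (σ : G), ∀ t ∈ T, σ • t ∈ T)
    (hf : ∀ σ τ : G, f.val σ τ ∈ T) : Subring (CrossedProduct f) where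
  carrier := {a | ∀ σ, a.coeff σ ∈ T}
  zero_mem' _ := T.zero_mem
  one_mem' σ := by
    classical
    rw [CrossedProduct.one_def, CrossedProduct.coeff_single]
    split_ifs
    exacts [T.one_mem, T.zero_mem]
  add_mem' ha hb σ := T.add_mem (ha σ) (hb σ)
  neg_mem' ha σ := T.neg_mem (ha σ)
  mul_mem' {a b} ha hb ρ := by
    classical
    let φ : CrossedProduct f →+ K := Finsupp.applyAddHom ρ
    change φ (a * b) ∈ T
    rw [CrossedProduct.mul_def, Finsupp.sum, map_sum]
    refine T.sum_mem fun σ _ => ?_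
    rw [Finsupp.sum, map_sum]
    refine T.sum_mem fun τ _ => ?_
    change (CrossedProduct.single f _ _).coeff ρ ∈ T
    rw [CrossedProduct.coeff_single]
    split_ifs
    · exact T.mul_mem (T.mul_mem (ha σ) (hT σ _ (hb τ))) (hf σ τ)
    · exact T.zero_mem

/-- A ring is hereditary if all its left ideals and all its right ideals are projective. Right
ideals are the left ideals of the opposite ring. -/
def IsHereditaryRing (A : Type*) [Ring A] : Prop :=
  (∀ I : Ideal A, Module.Projective A I) ∧
    ∀ I : Ideal Aᵐᵒᵖ, Module.Projective Aᵐᵒᵖ I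

/-- Let `R` be a domain with quotient field `k`. An `R`-order in a `k`-algebra `A` is a subring
`Λ` of `A`, with the same identity, that is a full `R`-lattice in `A`: it is a finitely generated
`R`-submodule of `A`, and it spans `A` over `k`. -/
def IsOrder (R k : Type*) {A : Type*} [CommRing R] [Field k] [Ring A] [Algebra R A] [Algebra k A]
    (Λ : Subring A) : Prop :=
  (∃ N : Submodule R A, N.FG ∧ (N : Set A) = Λ) ∧ Submodule.span k (Λ : Set A) = ⊤

/-- A maximal `R`-order in `A` is an `R`-order that is not properly contained in any `R`-order
in `A`. -/
def IsMaximalOrder (R k : Type*) {A : Type*} [CommRing R] [Field k] [Ring A] [Algebra R A]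
    [Algebra k A] (Λ : Subring A) : Prop :=
  IsOrder R k Λ ∧ ∀ Γ : Subring A, IsOrder R k Γ → Λ ≤ Γ → Γ = Λ

section Local

variable {V F K : Type*} [CommRing V] [Field F] [Field K] [Algebra V F] [Algebra V K]
  [Algebra F K] [IsScalarTower V F K]

/-- The decomposition group `D_M = {σ ∈ G | σ(M) = M}` of an ideal `M` of `S`, the integral
closure of `V` in `K`, where `G` is the Galois group of `K / F`. -/
def decompositionGroup (F : Type*) [Field F] [Algebra V F] [Algebra F K] [IsScalarTower V F K]
    (M : Ideal (integralClosure V K)) : Subgroup Gal(K/F) :=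
  MulAction.stabilizer Gal(K/F) M

/-- The decomposition field `K_M`, the fixed field of `D_M`. -/
def decompositionField (F : Type*) [Field F] [Algebra V F] [Algebra F K] [IsScalarTower V F K]
    (M : Ideal (integralClosure V K)) : IntermediateField F K :=
  IntermediateField.fixedField (decompositionGroup F M)

instance decompositionGroup_smulCommClass (M : Ideal (integralClosure V K)) :
    SMulCommClass (decompositionGroup F M) (decompositionField F M) K where
  smul_comm σ c x := by
    have hc : σ • (c : K) = c := c.2 σ
    change σ • ((c : K) * x) = (c : K) * σ • x
    rw [smul_mul', hc]

/-- The localization `S_M` of `S` at the prime ideal `M`, as the subring of all fractions `a / s`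
in `K` with `a ∈ S` and `s ∈ S \ M`. -/
def localization (M : Ideal (integralClosure V K)) [M.IsPrime] : Subring K where
  carrier := {x | ∃ a s : integralClosure V K, s ∉ M ∧ x = (a : K) / (s : K)}
  zero_mem' := ⟨0, 1, fun h => Ideal.IsPrime.ne_top ‹_› ((Ideal.eq_top_iff_one M).2 h), by simp⟩
  one_mem' := ⟨1, 1, fun h => Ideal.IsPrime.ne_top ‹_› ((Ideal.eq_top_iff_one M).2 h), by simp⟩
  add_mem' := by
    rintro _ _ ⟨a, s, hs, rfl⟩ ⟨b, t, ht, rfl⟩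
    have hs0 : (s : K) ≠ 0 := fun h => hs (by
      rw [show s = 0 from Subtype.ext h]; exact M.zero_mem)
    have ht0 : (t : K) ≠ 0 := fun h => ht (by
      rw [show t = 0 from Subtype.ext h]; exact M.zero_mem)
    refine ⟨a * t + s * b, s * t, fun h => (Ideal.IsPrime.mem_or_mem ‹_› h).elim hs ht, ?_⟩
    push_cast
    exact div_add_div _ _ hs0 ht0
  neg_mem' := by
    rintro _ ⟨a, s, hs, rfl⟩
    exact ⟨-a, s, hs, by push_cast; exact (neg_div _ _).symm⟩
  mul_mem' := by
    rintro _ _ ⟨a, s, hs, rfl⟩ ⟨b, t, ht, rfl⟩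
    refine ⟨a * b, s * t, fun h => (Ideal.IsPrime.mem_or_mem ‹_› h).elim hs ht, ?_⟩
    push_cast
    exact div_mul_div_comm _ _ _ _

theorem mem_localization_of_mem (M : Ideal (integralClosure V K)) [M.IsPrime] {x : K}
    (hx : x ∈ integralClosure V K) : x ∈ localization M :=
  ⟨⟨x, hx⟩, 1, fun h => Ideal.IsPrime.ne_top ‹_› ((Ideal.eq_top_iff_one M).2 h), by simp⟩

theorem smul_mem_localization (M : Ideal (integralClosure V K)) [M.IsPrime]
    (σ : decompositionGroup F M) (x : K) (hx : x ∈ localization M) :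
    σ • x ∈ localization M := by
  obtain ⟨a, s, hs, rfl⟩ := hx
  have hσ : (σ : Gal(K/F)) • M = M := σ.2
  refine ⟨(σ : Gal(K/F)) • a, (σ : Gal(K/F)) • s, fun h => hs ?_, map_div₀ (σ : Gal(K/F)) _ _⟩
  have h' : (σ : Gal(K/F)) • s ∈ (σ : Gal(K/F)) • M := by rwa [hσ]
  exact Ideal.smul_mem_pointwise_smul_iff.1 h'

/-- The valuation ring `S_M ∩ K_M` of the decomposition field `K_M`. -/
def localBase (F : Type*) [Field F] [Algebra V F] [Algebra F K] [IsScalarTower V F K]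
    (M : Ideal (integralClosure V K)) [M.IsPrime] : Subring (decompositionField F M) :=
  (localization M).comap (algebraMap (decompositionField F M) K)

/-- The crossed-product order `A_f = ∑_{σ ∈ G} S x_σ` in `Σ_f = (K / F, G, f)`. -/
def orderA (f : NormalizedCocycle Gal(K/F) K)
    (hf : ∀ σ τ, f.val σ τ ∈ integralClosure V K) : Subring (CrossedProduct f) :=
  crossedProductOrder f (integralClosure V K).toSubring
    (fun σ t ht => (σ • (⟨t, ht⟩ : integralClosure V K)).2) hf

/-- The cocycle `f_M`, the restriction of `f` to `D_M`. -/
def localCocycle (f : NormalizedCocycle Gal(K/F) K) (M : Ideal (integralClosure V K)) :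
    NormalizedCocycle (decompositionGroup F M) K :=
  f.restrict (decompositionGroup F M)

/-- The crossed-product order `A_{f_M} = ∑_{σ ∈ D_M} S_M x_σ` in
`Σ_{f_M} = (K / K_M, D_M, f_M)`. -/
def localOrderA (f : NormalizedCocycle Gal(K/F) K)
    (hf : ∀ σ τ, f.val σ τ ∈ integralClosure V K)
    (M : Ideal (integralClosure V K)) [M.IsPrime] :
    Subring (CrossedProduct (localCocycle f M)) :=
  crossedProductOrder (localCocycle f M) (localization M) (smul_mem_localization M)
    (fun σ τ => mem_localization_of_mem M (hf (σ : Gal(K/F)) (τ : Gal(K/F))))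

end Local

end CrossedOrder

open scoped Pointwise

namespace CrossedOrder

/-! ### Coefficients in a crossed product. -/

namespace CrossedProduct

variable {G K : Type*} [Group G] [Field K] [MulSemiringAction G K] {f : NormalizedCocycle G K}

/-! Heredity enters through one kind of left ideal. Let `π` be a uniformizer of `V` and `A = A_f`.
Since `A π + A x_σ` is projective, the surjection onto it from `A × A` splits; comparing
coefficients yields `π = π² p + q f(σ⁻¹, σ)` with `p, q ∈ S` (`exists_eq_sq_mul_add_of_projective`).
As `S` is unramified, `π ∉ M²`, so `f(σ⁻¹, σ) ∉ M²`. For `σ ∈ D_M` the cocycle identity spreads this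
to every `f(σ, τ)` with `τ ∈ D_M`: each value of `f_M` has `M`-adic order 0 or 1, hence divides `π`
in `S_M`.

This bound forces maximality. Let `Γ` be an order containing `A_{f_M}`. Inertia is trivial, so the
coefficients separate the degrees and `Γ` is graded (`single_coeff_mem`). If `Γ` were larger, it
would contain some `a x_σ` with `a ∉ S_M`, hence `π⁻¹ x_σ`. Divisibility of `π` by the cocycle
values then gives `π⁻¹ x_{σⁿ} ∈ Γ` for all `n ≥ 1`, in particular `π⁻¹ x_1 ∈ Γ`, although `π⁻¹` is
not integral over `S_M ∩ K_M` (`le_crossedProductOrder`, `isIntegral_of_single_mem`). -/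

theorem ext_coeff {a b : CrossedProduct f} (h : ∀ σ, a.coeff σ = b.coeff σ) : a = b :=
  toFinsupp.injective (Finsupp.ext h)

/-- The coefficient at `σ` as an additive homomorphism. -/
noncomputable def coeffHom (f : NormalizedCocycle G K) (σ : G) : CrossedProduct f →+ K :=
  (Finsupp.applyAddHom σ).comp toFinsupp.toAddMonoidHom

theorem coeff_zero (σ : G) : (0 : CrossedProduct f).coeff σ = 0 := rfl

theorem coeff_add (a b : CrossedProduct f) (σ : G) :
    (a + b).coeff σ = a.coeff σ + b.coeff σ := rfl

theorem coeff_sub (a b : CrossedProduct f) (σ : G) :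
    (a - b).coeff σ = a.coeff σ - b.coeff σ := rfl

theorem coeff_single_self (σ : G) (s : K) : (single f σ s).coeff σ = s :=
  Finsupp.single_eq_same

/-- Translation by `σ` is injective, so only the degree `τ` of `b` contributes. -/
theorem coeff_single_mul (σ τ : G) (s : K) (b : CrossedProduct f) :
    (single f σ s * b).coeff (σ * τ) = s * σ • b.coeff τ * f.val σ τ := by
  classical
  induction b using induction with
  | h0 => simp [coeff_zero]
  | hadd b b' hb hb' => rw [mul_add, coeff_add, coeff_add, hb, hb', smul_add]; ring
  | hs ρ t =>
    rw [single_mul_single, coeff_single, coeff_single]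
    by_cases h : ρ = τ
    · simp [h]
    · simp [h]

theorem coeff_mul_single (σ τ : G) (t : K) (a : CrossedProduct f) :
    (a * single f τ t).coeff (σ * τ) = a.coeff σ * σ • t * f.val σ τ := by
  classical
  induction a using induction with
  | h0 => simp [coeff_zero]
  | hadd b b' hb hb' => rw [add_mul, coeff_add, coeff_add, hb, hb']; ring
  | hs ρ s =>
    rw [single_mul_single, coeff_single, coeff_single]
    by_cases h : ρ = σ
    · simp [h]
    · simp [h]

theorem coeff_single_one_mul (τ : G) (s : K) (b : CrossedProduct f) :
    (single f 1 s * b).coeff τ = s * b.coeff τ := by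
  simpa [f.val_one_left] using coeff_single_mul 1 τ s b

theorem coeff_mul_single_one (σ : G) (t : K) (a : CrossedProduct f) :
    (a * single f 1 t).coeff σ = a.coeff σ * σ • t := by
  simpa [f.val_one_right] using coeff_mul_single σ 1 t a

theorem single_one_mul_single (τ : G) (s t : K) :
    single f 1 s * single f τ t = single f τ (s * t) := by
  simp [single_mul_single, f.val_one_left]

theorem sum_single_coeff [Fintype G] (a : CrossedProduct f) :
    ∑ σ, single f σ (a.coeff σ) = a := by
  classical
  refine ext_coeff fun τ => ?_
  change coeffHom f τ _ = _
  rw [map_sum]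
  change ∑ σ, (single f σ (a.coeff σ)).coeff τ = _
  simp [coeff_single]

/-- The embedding `s ↦ s x_1` of `K` into the crossed product. -/
noncomputable def embed (f : NormalizedCocycle G K) : K →+* CrossedProduct f :=
  scalarHom K

theorem embed_apply (s : K) : embed f s = single f 1 s := rfl

theorem embed_injective : Function.Injective (embed f) := fun s t h => by
  rw [embed_apply, embed_apply] at h
  rw [← coeff_single_self (f := f) 1 s, h, coeff_single_self]

end CrossedProduct

open CrossedProduct

/-! ### Crossed-product orders over a general stable subring. -/

section Abstract

variable {G K : Type*} [Group G] [Field K] [MulSemiringAction G K] (f : NormalizedCocycle G K)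
  (T : Subring K) (hT : ∀ σ : G, ∀ t ∈ T, σ • t ∈ T) (hf : ∀ σ τ : G, f.val σ τ ∈ T)

theorem single_mem_crossedProductOrder (σ : G) {s : K} (hs : s ∈ T) :
    single f σ s ∈ crossedProductOrder f T hT hf := fun τ => by
  classical
  rw [coeff_single]
  split_ifs
  exacts [hs, T.zero_mem]

/-- If the left ideal `A π + A x_σ` of the crossed-product order `A` is projective, where `π` is
fixed by the group, then `π` is a combination of `π ^ 2` and `f(σ⁻¹, σ)`. -/
theorem exists_eq_sq_mul_add_of_projective
    (hA : ∀ I : Ideal (crossedProductOrder f T hT hf),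
      Module.Projective (crossedProductOrder f T hT hf) I)
    (σ : G) {π : K} (hπ : π ∈ T) (hfix : ∀ τ : G, τ • π = π) :
    ∃ p ∈ T, ∃ q ∈ T, π = π ^ 2 * p + q * f.val σ⁻¹ σ := by
  set A := crossedProductOrder f T hT hf
  by_cases h0 : π = 0
  · exact ⟨0, T.zero_mem, 0, T.zero_mem, by simp [h0]⟩
  let c : A := ⟨single f 1 π, single_mem_crossedProductOrder f T hT hf 1 hπ⟩
  let x : A := ⟨single f σ 1, single_mem_crossedProductOrder f T hT hf σ T.one_mem⟩
  let φ : A × A →ₗ[A] A :=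
    (LinearMap.toSpanSingleton A A c).coprod (LinearMap.toSpanSingleton A A x)
  have hφ (a b : A) : φ (a, b) = a * c + b * x := rfl
  have := hA (LinearMap.range φ)
  -- `g` is a section of `(a, b) ↦ a π + b x_σ`.
  obtain ⟨g, hg⟩ := Module.projective_lifting_property φ.rangeRestrict LinearMap.id
    φ.surjective_rangeRestrict
  let yc : LinearMap.range φ := ⟨c, (1, 0), by simp [hφ]⟩
  let yx : LinearMap.range φ := ⟨x, (0, 1), by simp [hφ]⟩
  -- Since `π` is fixed by `σ`, this is a syzygy between the two generators. Applying `g` to it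
  -- constrains the values of `g` on them.
  have hcx : x * c = c * x := Subtype.ext <| by
    change single f σ 1 * single f 1 π = single f 1 π * single f σ 1
    simp [single_mul_single, hfix, f.val_one_left, f.val_one_right]
  have hyy : x • yc = c • yx := Subtype.ext hcx
  have h1 : x • g yc = c • g yx := by rw [← map_smul, hyy, map_smul]
  rcases hP : g yc with ⟨P, Q⟩
  rcases hP' : g yx with ⟨P', Q'⟩
  rw [hP, hP'] at h1
  have h2 : x * P = c * P' := congrArg Prod.fst h1
  have h3 : P * c + Q * x = c := by
    have := congrArg (fun l => ((l yc : LinearMap.range φ) : A)) hg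
    rw [← hφ, ← hP]
    exact this
  have h2' : single f σ 1 * (P : CrossedProduct f) = single f 1 π * P' :=
    congrArg Subtype.val h2
  have h3' : (P : CrossedProduct f) * single f 1 π + Q * single f σ 1 = single f 1 π :=
    congrArg Subtype.val h3
  -- The indices `σ * 1` and `σ⁻¹ * σ` are left unsimplified to match the coefficient formulas.
  have h4 := congrArg (fun a => a.coeff (σ * 1)) h2'
  have h5 := congrArg (fun a => a.coeff (σ⁻¹ * σ)) h3'
  simp only [coeff_single_mul, coeff_add, coeff_mul_single] at h4 h5
  simp only [mul_one, inv_mul_cancel, coeff_mul_single_one, coeff_single_one_mul,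
    coeff_single_self, f.val_one_right, one_mul, hfix, smul_one] at h4 h5
  refine ⟨σ⁻¹ • (P' : CrossedProduct f).coeff σ, hT _ _ (P'.2 σ),
    (Q : CrossedProduct f).coeff σ⁻¹, Q.2 σ⁻¹, ?_⟩
  -- The syzygy makes the degree 1 coefficient of `P` divisible by `π`; this supplies the second
  -- factor `π` in `π²`.
  have h6 : (P : CrossedProduct f).coeff 1 = π * σ⁻¹ • (P' : CrossedProduct f).coeff σ := by
    rw [eq_inv_smul_iff.2 h4, smul_mul', hfix]
  rw [h6] at h5
  linear_combination -h5

/-- A subring of the crossed product that contains a sufficiently separated ring of coefficients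
is a graded subgroup. -/
theorem single_coeff_mem [Finite G] {Γ : Subring (CrossedProduct f)}
    (hΓ : ∀ t ∈ T, single f 1 t ∈ Γ)
    (hsep : ∀ σ τ : G, σ ≠ τ → ∃ r ∈ T, σ • r ≠ τ • r ∧ (σ • r - τ • r)⁻¹ ∈ T)
    {y : CrossedProduct f} (hy : y ∈ Γ) (σ : G)
    (hT : ∀ σ : G, ∀ t ∈ T, σ • t ∈ T) :
    single f σ (y.coeff σ) ∈ Γ := by
  classical
  have := Fintype.ofFinite G
  -- The degrees in `s` are killed one at a time. Replacing `z` by `(σ r - τ r)⁻¹ (z r - τ(r) z)`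
  -- scales degree `ρ` by `(ρ r - τ r) / (σ r - τ r)`, which is 1 at `σ` and 0 at `τ`.
  have key (s : Finset G) (hs : σ ∉ s) :
      ∃ z ∈ Γ, z.coeff σ = y.coeff σ ∧ ∀ τ ∈ s, z.coeff τ = 0 := by
    induction s using Finset.induction_on with
    | empty => exact ⟨y, hy, rfl, by simp⟩
    | insert τ s hτ ih =>
      rw [Finset.mem_insert, not_or] at hs
      obtain ⟨z, hz, hzσ, hzs⟩ := ih hs.2
      obtain ⟨r, hr, hne, hinv⟩ := hsep σ τ hs.1
      have hcoeff (ρ : G) : (single f 1 (σ • r - τ • r)⁻¹ *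
          (z * single f 1 r - single f 1 (τ • r) * z)).coeff ρ =
          (σ • r - τ • r)⁻¹ * (z.coeff ρ * (ρ • r - τ • r)) := by
        rw [coeff_single_one_mul, coeff_sub, coeff_mul_single_one, coeff_single_one_mul]
        ring
      refine ⟨_, Γ.mul_mem (hΓ _ hinv) (Γ.sub_mem (Γ.mul_mem hz (hΓ r hr))
        (Γ.mul_mem (hΓ _ (hT τ r hr)) hz)), ?_, fun ρ hρ => ?_⟩
      · rw [hcoeff, hzσ, mul_comm, mul_assoc, mul_inv_cancel₀ (sub_ne_zero.2 hne), mul_one]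
      · rw [hcoeff]
        rcases Finset.mem_insert.1 hρ with rfl | hρ
        · simp
        · simp [hzs ρ hρ]
  obtain ⟨z, hz, hzσ, hz0⟩ := key (Finset.univ.erase σ) (by simp)
  convert hz
  refine ext_coeff fun τ => ?_
  rw [coeff_single]
  split_ifs with h
  · rw [← h, hzσ]
  · exact (hz0 τ (by simp [Ne.symm h])).symm

/-- If `π` is divisible by all values of the cocycle, then the crossed-product order contains
every larger subring in which `π` is not a unit. -/
theorem le_crossedProductOrder [Finite G] {Γ : Subring (CrossedProduct f)}
    (hΓ : crossedProductOrder f T hT hf ≤ Γ)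
    (hsep : ∀ σ τ : G, σ ≠ τ → ∃ r ∈ T, σ • r ≠ τ • r ∧ (σ • r - τ • r)⁻¹ ∈ T)
    {π : K} (hπ0 : π ≠ 0) (hfix : ∀ τ : G, τ • π = π)
    (hdiv : ∀ a ∉ T, (π * a)⁻¹ ∈ T) (hval : ∀ σ τ : G, π / f.val σ τ ∈ T)
    (hπΓ : single f 1 π⁻¹ ∉ Γ) :
    Γ ≤ crossedProductOrder f T hT hf := by
  have hmem {t : K} (ht : t ∈ T) : single f 1 t ∈ Γ :=
    hΓ (single_mem_crossedProductOrder f T hT hf 1 ht)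
  have hinv (τ : G) : τ • π⁻¹ = π⁻¹ := by rw [smul_inv'', hfix]
  intro y hy σ
  by_contra hσ
  have hyσ := single_coeff_mem f T (fun _ => hmem) hsep hy σ hT
  have hne : y.coeff σ ≠ 0 := fun h => hσ (h ▸ T.zero_mem)
  -- With `a` the coefficient of `y` at `σ`, this is `(π a)⁻¹ · a x_σ`.
  have h1 : single f σ π⁻¹ ∈ Γ := by
    have := Γ.mul_mem (hmem (hdiv _ hσ)) hyσ
    rw [single_one_mul_single] at this
    convert this using 2
    field_simp
  -- The product of `π⁻¹ x_{σⁿ⁺¹}` and `π⁻¹ x_σ` is `π⁻² f(σⁿ⁺¹, σ) x_{σⁿ⁺²}`; the factor `π /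
  -- f(σⁿ⁺¹, σ)` restores `π⁻¹`.
  have hpow (n : ℕ) : single f (σ ^ (n + 1)) π⁻¹ ∈ Γ := by
    induction n with
    | zero => simpa using h1
    | succ n ih =>
      have := Γ.mul_mem (hmem (hval (σ ^ (n + 1)) σ)) (Γ.mul_mem ih h1)
      rw [single_mul_single, single_one_mul_single, hinv, ← pow_succ] at this
      convert this using 2
      have := f.val_ne_zero (σ ^ (n + 1)) σ
      field_simp
  apply hπΓ
  have := hpow (orderOf σ - 1)
  rwa [Nat.sub_add_cancel (orderOf_pos σ), pow_orderOf_eq_one] at this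

/-- Scalars in an order are integral. -/
theorem isIntegral_of_single_mem {R k : Type*} [CommRing R] [Field k] [Algebra R K]
    [Algebra R (CrossedProduct f)] [Algebra k (CrossedProduct f)]
    (hmap : ∀ c : R, algebraMap R (CrossedProduct f) c = single f 1 (algebraMap R K c))
    {Γ : Subring (CrossedProduct f)} (hΓ : IsOrder R k Γ) {a : K} (ha : single f 1 a ∈ Γ) :
    IsIntegral R a := by
  obtain ⟨⟨N, hN, hNΓ⟩, -⟩ := hΓ
  have hN' {x : CrossedProduct f} : x ∈ N ↔ x ∈ Γ := by
    rw [← SetLike.mem_coe, hNΓ, SetLike.mem_coe]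
  -- `N` is an `R`-submodule containing 1, so `Γ` contains the scalars and is a module-finite
  -- `R`-algebra, whose elements are integral.
  let B : Subalgebra R (CrossedProduct f) :=
    { Γ with
      algebraMap_mem' := fun c => by
        change algebraMap R (CrossedProduct f) c ∈ Γ
        rw [Algebra.algebraMap_eq_smul_one, ← hN']
        exact N.smul_mem c (hN'.2 Γ.one_mem) }
  have hB : Subalgebra.toSubmodule B = N := Submodule.ext fun x => hN'.symm
  have h1 : IsIntegral R (single f 1 a) :=
    IsIntegral.of_mem_of_fg B (hB ▸ hN) _ ha
  let e : K →ₐ[R] CrossedProduct f := { embed f with commutes' := fun c => (hmap c).symm }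
  exact (isIntegral_algHom_iff e (embed_injective (f := f))).1 h1

end Abstract

/-! ### The localization at `M` and its decomposition field. -/

open IsDedekindDomain

/-- Turns divisibility questions in `S_M` into inequalities between `M`-adic values. -/
theorem mem_localization_iff {V K : Type*} [CommRing V] [Field K] [Algebra V K]
    [IsDedekindDomain (integralClosure V K)]
    [IsFractionRing (integralClosure V K) K]
    (v : HeightOneSpectrum (integralClosure V K)) {M : Ideal (integralClosure V K)} [M.IsPrime]
    (hv : v.asIdeal = M) {x : K} :
    x ∈ localization M ↔ v.valuation K x ≤ 1 := by
  subst hv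
  constructor
  · rintro ⟨a, s, hs, rfl⟩
    have h1 : v.valuation K (s : K) = 1 := (v.valuation_eq_one_iff_notMem (K := K)).2 hs
    have h2 : v.valuation K (a : K) ≤ 1 := v.valuation_le_one (K := K) a
    rwa [map_div₀, h1, div_one]
  · intro hx
    obtain ⟨n, d, h⟩ := v.exists_primeCompl_mul_eq_of_integer x hx
    refine ⟨n, d, d.2, ?_⟩
    have hd : ((d : integralClosure V K) : K) ≠ 0 := fun h0 => d.2 <| by
      rw [show (d : integralClosure V K) = 0 from Subtype.ext h0]
      exact v.asIdeal.zero_mem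
    exact eq_div_of_mul_eq hd h

section Localization

variable {V F K : Type*} [CommRing V] [Field F] [Field K] [Algebra V F] [Algebra V K]
  [Algebra F K] [IsScalarTower V F K]

theorem smul_mem_pow_iff (M : Ideal (integralClosure V K)) (σ : decompositionGroup F M)
    {x : integralClosure V K} {n : ℕ} : (σ : Gal(K/F)) • x ∈ M ^ n ↔ x ∈ M ^ n := by
  have hσ : (σ : Gal(K/F)) • M = M := σ.2
  have h : (σ : Gal(K/F)) • M ^ n = M ^ n := by rw [smul_pow', hσ]
  conv_lhs => rw [← h]
  exact Ideal.smul_mem_pointwise_smul_iff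

theorem smul_mem_iff (M : Ideal (integralClosure V K)) (σ : decompositionGroup F M)
    {x : integralClosure V K} : (σ : Gal(K/F)) • x ∈ M ↔ x ∈ M := by
  simpa only [pow_one] using smul_mem_pow_iff M σ (n := 1)

theorem algebraMap_localBase_crossedProduct (f : NormalizedCocycle Gal(K/F) K)
    (M : Ideal (integralClosure V K)) [M.IsPrime] (c : localBase F M) :
    algebraMap (localBase F M) (CrossedProduct (localCocycle f M)) c =
      single (localCocycle f M) 1 (algebraMap (localBase F M) K c) := rfl

/-- The localization at `M` is generated by the integral closure over the valuation ring of the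
decomposition field. -/
theorem exists_mem_localBase_mul [FiniteDimensional F K] (M : Ideal (integralClosure V K)) [M.IsPrime] {x : K}
    (hx : x ∈ localization M) :
    ∃ c : localBase F M, ∃ b : integralClosure V K, x = algebraMap (localBase F M) K c * b := by
  classical
  obtain ⟨a, s, hs, rfl⟩ := hx
  have := Fintype.ofFinite (decompositionGroup F M)
  -- The norm of `s` over `D_M` lies in the decomposition field and stays outside `M`. Thus `a / s =
  -- N⁻¹ · (a ∏_{σ ≠ 1} σ s)`, with the denominator in the base.
  set N : integralClosure V K := ∏ σ : decompositionGroup F M, (σ : Gal(K/F)) • s with hN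
  have hNM : N ∉ M := by
    rw [hN, Ideal.IsPrime.prod_mem_iff]
    rintro ⟨σ, -, h⟩
    exact hs ((smul_mem_iff M σ).1 h)
  have hfix (τ : decompositionGroup F M) : (τ : Gal(K/F)) • N = N := by
    rw [hN, Finset.smul_prod']
    refine Fintype.prod_equiv (Equiv.mulLeft τ) _ _ fun σ => ?_
    rw [smul_smul]
    rfl
  have hinv (τ : decompositionGroup F M) : (τ : Gal(K/F)) (N : K)⁻¹ = (N : K)⁻¹ := by
    rw [map_inv₀]
    congr 1
    exact congrArg Subtype.val (hfix τ)
  have hsN : N = s * ∏ σ ∈ Finset.univ.erase (1 : decompositionGroup F M),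
      (σ : Gal(K/F)) • s := by
    rw [hN, ← Finset.mul_prod_erase _ _ (Finset.mem_univ 1)]
    simp
  have hs0 : (s : K) ≠ 0 := fun h => hs (by
    rw [show s = 0 from Subtype.ext h]; exact M.zero_mem)
  have hN0 : (N : K) ≠ 0 := fun h => hNM (by
    rw [show N = 0 from Subtype.ext h]; exact M.zero_mem)
  let c : decompositionField F M := ⟨(N : K)⁻¹, fun τ => hinv τ⟩
  refine ⟨⟨c, 1, N, hNM, by simp [c]⟩, a * ∏ σ ∈ Finset.univ.erase
    (1 : decompositionGroup F M), (σ : Gal(K/F)) • s, ?_⟩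
  change (a : K) / s = (N : K)⁻¹ * _
  have h := congrArg (Subtype.val : integralClosure V K → K) hsN
  push_cast at h ⊢
  rw [h] at hN0 ⊢
  have := right_ne_zero_of_mul hN0
  field_simp

end Localization

/-! ### Consequences of unramifiedness, and the lattice property. -/

section Arithmetic

variable {V F K : Type*} [CommRing V] [IsDomain V] [IsDiscreteValuationRing V]
  [Field F] [Algebra V F] [IsFractionRing V F]
  [Field K] [Algebra F K] [FiniteDimensional F K] [IsGalois F K]
  [Algebra V K] [IsScalarTower V F K]

/-- The inertia groups of an unramified extension are trivial. -/
theorem exists_smul_sub_notMem [Algebra.FormallyUnramified V (integralClosure V K)]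
    (M : Ideal (integralClosure V K)) [M.IsPrime] {τ : Gal(K/F)} (hτ : τ ≠ 1) :
    ∃ r : integralClosure V K, τ • r - r ∉ M := by
  have := IsIntegralClosure.isNoetherianRing V F K (integralClosure V K)
  have := integralClosure.isFractionRing_of_finite_extension (A := V) F K
  by_contra! h
  -- If `τ` is the identity modulo `M`, unramifiedness propagates this to every power of `M`, and
  -- these powers intersect in zero.
  have hext : MulSemiringAction.toAlgHom V (integralClosure V K) τ = AlgHom.id V _ :=
    Algebra.FormallyUnramified.ext_of_iInf M
      (Ideal.iInf_pow_eq_bot_of_isDomain M (Ideal.IsPrime.ne_top ‹_›))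
      fun x => Ideal.Quotient.eq.2 (h x)
  apply hτ
  ext x
  obtain ⟨a, b, -, rfl⟩ := IsFractionRing.div_surjective (A := integralClosure V K) x
  have hfix (c : integralClosure V K) : τ (c : K) = c :=
    congrArg Subtype.val (DFunLike.congr_fun hext c)
  change τ ((a : K) / (b : K)) = (a : K) / (b : K)
  rw [map_div₀, hfix, hfix]

/-- A uniformizer of the base is not in the square of a maximal ideal of an unramified
extension. -/
theorem algebraMap_notMem_sq (F : Type*) [Field F] [Algebra V F] [IsFractionRing V F]
    [Algebra F K] [FiniteDimensional F K] [IsGalois F K] [IsScalarTower V F K]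
    [Algebra.FormallyUnramified V (integralClosure V K)]
    (M : Ideal (integralClosure V K)) [M.IsMaximal] {π : V} (hπ : Irreducible π) :
    algebraMap V (integralClosure V K) π ∉ M ^ 2 := by
  have := integralClosure.isDedekindDomain V F K
  have : Module.Finite V (integralClosure V K) := IsIntegralClosure.finite V F K _
  intro h
  have hrad := Algebra.FormallyUnramified.isRadical_map_isMaximal V (integralClosure V K)
    (IsLocalRing.maximalIdeal V)
  rw [hπ.maximalIdeal_eq, Ideal.map_span, Set.image_singleton] at hrad
  set I := Ideal.span {algebraMap V (integralClosure V K) π} with hI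
  have hI0 : I ≠ ⊥ := by
    have : FaithfulSMul V K := (faithfulSMul_iff_algebraMap_injective V K).2 <| by
      rw [IsScalarTower.algebraMap_eq V F K]
      exact (algebraMap F K).injective.comp (IsFractionRing.injective V F)
    rw [hI, Ne, Ideal.span_singleton_eq_bot]
    intro h0
    have h1 : algebraMap V K π = 0 := congrArg Subtype.val h0
    exact hπ.ne_zero ((FaithfulSMul.algebraMap_eq_zero_iff V K).1 h1)
  obtain ⟨J, hJ⟩ := Ideal.dvd_iff_le.2 ((Ideal.span_singleton_le_iff_mem _).2 h)
  -- From `I = M² J` follows `(M J)² ⊆ I`, and `I` is radical. So `M · M J = M J`, and cancelling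
  -- the nonzero ideal `M J` gives `M = 1`.
  have hle : M * J ≤ I := by
    intro y hy
    refine hrad ⟨2, ?_⟩
    rw [hI, hJ, pow_two y]
    have : M * J * (M * J) ≤ M ^ 2 * J := by
      calc M * J * (M * J) = M ^ 2 * J * J := by ring
        _ ≤ M ^ 2 * J := Ideal.mul_le_left
    exact this (Ideal.mul_mem_mul hy hy)
  have hMJ0 : M * J ≠ 0 := by
    intro h0
    apply hI0
    rw [hI, hJ, pow_two, mul_assoc, h0, mul_zero, Ideal.zero_eq_bot]
  have h1 : M * (M * J) = 1 * (M * J) := by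
    rw [one_mul]
    refine le_antisymm Ideal.mul_le_right ?_
    rw [← mul_assoc, ← pow_two, ← hJ]
    exact hle
  have h2 := mul_right_cancel₀ hMJ0 h1
  exact Ideal.IsPrime.ne_top (I := M) inferInstance (by rw [h2, Ideal.one_eq_top])

theorem algebraMap_mem_of_isMaximal (F : Type*) [Field F] [Algebra V F] [IsFractionRing V F]
    [Algebra F K] [IsScalarTower V F K]
    (M : Ideal (integralClosure V K)) [M.IsMaximal] {π : V} (hπ : Irreducible π) :
    algebraMap V (integralClosure V K) π ∈ M := by
  have : (M.under V).IsMaximal := Ideal.IsMaximal.under V M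
  have h := IsLocalRing.eq_maximalIdeal this
  have : π ∈ M.under V := by
    rw [h, hπ.maximalIdeal_eq]
    exact Ideal.mem_span_singleton_self π
  exact this

/-- Finite generation: `S` is finite over `V`, and `S_M` is spanned by `S` over the local base.
Spanning: every element of `K` becomes integral after multiplication by a nonzero element of `V`. -/
theorem isOrder_localOrderA (f : NormalizedCocycle Gal(K/F) K)
    (hf : ∀ σ τ, f.val σ τ ∈ integralClosure V K)
    (M : Ideal (integralClosure V K)) [M.IsPrime] :
    IsOrder (localBase F M) (decompositionField F M) (localOrderA f hf M) := by
  classical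
  have := Fintype.ofFinite (decompositionGroup F M)
  constructor
  · have : Module.Finite V (integralClosure V K) := IsIntegralClosure.finite V F K _
    obtain ⟨t, ht⟩ := Module.finite_def.1 this
    let N : Submodule (localBase F M) (CrossedProduct (localCocycle f M)) :=
      Submodule.span _ ((Finset.univ ×ˢ t).image fun p => single (localCocycle f M) p.1 (p.2 : K))
    refine ⟨N, ⟨_, rfl⟩, Set.Subset.antisymm ?_ ?_⟩
    · intro a ha
      refine Submodule.span_induction (p := fun a _ => a ∈ localOrderA f hf M) ?_
        (zero_mem _) (fun _ _ _ _ => add_mem) ?_ ha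
      · intro a ha
        obtain ⟨p, -, rfl⟩ := Finset.mem_image.1 ha
        exact single_mem_crossedProductOrder _ _ _ _ _ (mem_localization_of_mem M p.2.2)
      · intro c a _ ha
        rw [Algebra.smul_def]
        refine mul_mem ?_ ha
        rw [algebraMap_localBase_crossedProduct]
        exact single_mem_crossedProductOrder _ _ _ _ _ c.2
    · intro a ha
      have hV (σ : decompositionGroup F M) (b : integralClosure V K) :
          single (localCocycle f M) σ (b : K) ∈ N := by
        have hb : b ∈ Submodule.span V (t : Set (integralClosure V K)) := ht ▸ Submodule.mem_top
        induction hb using Submodule.span_induction with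
        | mem b hb =>
          exact Submodule.subset_span (Finset.mem_coe.2 (Finset.mem_image.2
            ⟨(σ, b), Finset.mem_product.2 ⟨Finset.mem_univ _, hb⟩, rfl⟩))
        | zero => simp [single_zero]
        | add b b' _ _ hb hb' =>
          rw [Subalgebra.coe_add, single_add]
          exact N.add_mem hb hb'
        | smul c b _ hb =>
          let c' : localBase F M := ⟨algebraMap V (decompositionField F M) c,
            mem_localization_of_mem M (algebraMap V (integralClosure V K) c).2⟩
          have := N.smul_mem c' hb
          rw [Algebra.smul_def, algebraMap_localBase_crossedProduct,
            single_one_mul_single] at this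
          rw [Algebra.smul_def]
          exact this
      rw [← sum_single_coeff a]
      refine N.sum_mem fun σ _ => ?_
      obtain ⟨c, b, h⟩ := exists_mem_localBase_mul (F := F) M (ha σ)
      rw [h, ← single_one_mul_single, ← algebraMap_localBase_crossedProduct,
        ← Algebra.smul_def]
      exact N.smul_mem _ (hV σ b)
  · refine eq_top_iff.2 fun a _ => ?_
    rw [← sum_single_coeff a]
    refine Submodule.sum_mem _ fun σ _ => ?_
    have halg : IsAlgebraic V (a.coeff σ) :=
      (IsFractionRing.isAlgebraic_iff V F K).2 (Algebra.IsAlgebraic.isAlgebraic _)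
    obtain ⟨y, hy, hint⟩ := halg.exists_integral_multiple
    have hy' : algebraMap V F y ≠ 0 := by
      simpa using hy
    let d : decompositionField F M := algebraMap F _ (algebraMap V F y)⁻¹
    have := Submodule.smul_mem (Submodule.span (decompositionField F M)
      (localOrderA f hf M : Set (CrossedProduct (localCocycle f M)))) d
      (Submodule.subset_span (single_mem_crossedProductOrder _ _ (smul_mem_localization M)
        (fun σ τ => mem_localization_of_mem M (hf σ τ)) σ (mem_localization_of_mem M hint)))
    rw [Algebra.smul_def] at this
    change single _ 1 (algebraMap F K (algebraMap V F y)⁻¹) * single _ σ _ ∈ _ at this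
    rw [single_one_mul_single] at this
    convert this using 2
    rw [Algebra.smul_def, IsScalarTower.algebraMap_apply V F K, ← mul_assoc, ← map_mul,
      inv_mul_cancel₀ hy', map_one, one_mul]

end Arithmetic

/-! ### Maximality from the bound on the cocycle, and the bound from heredity. -/

open WithZero in
theorem isMaximalOrder_localOrderA {V F K : Type*} [CommRing V] [IsDomain V]
    [IsDiscreteValuationRing V] [Field F] [Algebra V F] [IsFractionRing V F]
    [Field K] [Algebra F K] [FiniteDimensional F K] [IsGalois F K]
    [Algebra V K] [IsScalarTower V F K]
    [Algebra.FormallyUnramified V (integralClosure V K)]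
    (f : NormalizedCocycle Gal(K/F) K)
    (hf : ∀ σ τ, f.val σ τ ∈ integralClosure V K)
    (M : Ideal (integralClosure V K)) [M.IsMaximal]
    (hsq : ∀ σ ∈ decompositionGroup F M,
      (⟨f.val σ⁻¹ σ, hf _ _⟩ : integralClosure V K) ∉ M ^ 2) :
    IsMaximalOrder (localBase F M) (decompositionField F M) (localOrderA f hf M) := by
  refine ⟨isOrder_localOrderA f hf M, fun Γ hΓ hle => le_antisymm ?_ hle⟩
  have := integralClosure.isDedekindDomain V F K
  have := integralClosure.isFractionRing_of_finite_extension (A := V) F K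
  obtain ⟨π, hπ⟩ := IsDiscreteValuationRing.exists_irreducible V
  have hπM := algebraMap_mem_of_isMaximal F M hπ
  have hπM2 := algebraMap_notMem_sq F M hπ
  have hM0 : M ≠ ⊥ := by
    rintro rfl
    apply hπM2
    rw [Ideal.mem_bot.1 hπM]
    exact zero_mem _
  let v : HeightOneSpectrum (integralClosure V K) := ⟨M, inferInstance, hM0⟩
  have hmem {x : K} : x ∈ localization M ↔ v.valuation K x ≤ 1 := mem_localization_iff v rfl
  -- Values are discrete: not lying in `M²` means having order at most 1.
  have hval (x : integralClosure V K) (hx : x ∉ M ^ 2) : exp (-1 : ℤ) ≤ v.valuation K (x : K) := by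
    have h1 : ¬ v.intValuation x ≤ exp (-(2 : ℕ) : ℤ) := fun h =>
      hx ((v.intValuation_le_pow_iff_mem x 2).1 h)
    have h2 : v.valuation K (x : K) = v.intValuation x := v.valuation_of_algebraMap (K := K) x
    have h0 : v.intValuation x ≠ 0 := fun h => h1 (by rw [h]; exact zero_le)
    rw [h2]
    rw [not_le, ← exp_log h0, exp_lt_exp] at h1
    rw [← exp_log h0, exp_le_exp]
    push_cast at h1
    omega
  let p : K := algebraMap V K π
  have hvp : v.valuation K p = exp (-1 : ℤ) := by
    refine le_antisymm ?_ (hval _ hπM2)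
    have h2 : v.valuation K p = v.intValuation (algebraMap V (integralClosure V K) π) :=
      v.valuation_of_algebraMap (K := K) (algebraMap V (integralClosure V K) π)
    rw [h2]
    exact (v.intValuation_le_pow_iff_mem _ 1).2 (by rwa [pow_one])
  have hp0 : p ≠ 0 := fun h => by
    rw [h, map_zero] at hvp
    exact exp_ne_zero hvp.symm
  have hfix (τ : decompositionGroup F M) : τ • p = p := by
    change (τ : Gal(K/F)) (algebraMap V K π) = algebraMap V K π
    rw [IsScalarTower.algebraMap_apply V F K, AlgEquiv.commutes]
  refine le_crossedProductOrder (localCocycle f M) (localization M) (smul_mem_localization M)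
    _ hle ?_ hp0 hfix ?_ ?_ ?_
  · intro σ τ hστ
    have hne : ((τ⁻¹ * σ : decompositionGroup F M) : Gal(K/F)) ≠ 1 := fun h => hστ <| by
      rw [← inv_mul_eq_one.1 (Subtype.ext h)]
    obtain ⟨r, hr⟩ := exists_smul_sub_notMem M hne
    have hr' : (σ : Gal(K/F)) • r - (τ : Gal(K/F)) • r ∉ M := by
      rw [← smul_mem_iff M τ⁻¹, smul_sub, smul_smul, smul_smul]
      simpa using hr
    refine ⟨r, mem_localization_of_mem M r.2, fun h => hr' ?_, 1, _, hr', ?_⟩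
    · rw [show (σ : Gal(K/F)) • r - (τ : Gal(K/F)) • r = 0 from
        Subtype.ext (sub_eq_zero.2 h)]
      exact M.zero_mem
    · rw [OneMemClass.coe_one, one_div]
      rfl
  · intro a ha
    rw [hmem, not_le] at ha
    have h0 : v.valuation K a ≠ 0 := (zero_lt_one.trans ha).ne'
    rw [hmem, map_inv₀, map_mul, hvp, ← exp_log h0, ← exp_add, ← exp_neg, ← exp_zero, exp_le_exp]
    rw [← exp_log h0, ← exp_zero, exp_lt_exp] at ha
    omega
  · intro σ τ
    -- The cocycle identity for `(σ⁻¹, σ, τ)` reads `σ⁻¹(f(σ, τ)) f(σ⁻¹, στ) = f(σ⁻¹, σ)`, and `D_M`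
    -- stabilizes `M²`.
    have hστ : (⟨f.val σ τ, hf _ _⟩ : integralClosure V K) ∉ M ^ 2 := by
      intro h
      apply hsq σ σ.2
      have h1 := f.val_cocycle (σ : Gal(K/F))⁻¹ σ τ
      rw [inv_mul_cancel, f.val_one_left, mul_one] at h1
      rw [← smul_mem_pow_iff M σ⁻¹] at h
      have h2 := Ideal.mul_mem_right
        (⟨f.val (σ : Gal(K/F))⁻¹ (σ * τ), hf _ _⟩ : integralClosure V K) _ h
      convert h2
      exact h1.symm
    have h1 := hval _ hστ
    rw [hmem, map_div₀, hvp]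
    exact div_le_one_of_le₀ h1 zero_le
  · intro h
    have h1 : IsIntegral (localBase F M) p⁻¹ :=
      isIntegral_of_single_mem _ (algebraMap_localBase_crossedProduct f M) hΓ h
    -- Integrality passes to the valuation ring of `v`, which is integrally closed, whereas `p⁻¹`
    -- has value greater than 1.
    have h2 : IsIntegral (v.valuation K).integer p⁻¹ := by
      obtain ⟨q, hq, hq0⟩ := h1
      let g : localBase F M →+* (v.valuation K).integer :=
        (algebraMap (localBase F M) K).codRestrict _ fun c => hmem.1 c.2
      refine ⟨q.map g, hq.map g, ?_⟩
      rw [Polynomial.eval₂_map]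
      exact hq0
    have h3 : v.valuation K p⁻¹ ≤ 1 := Valuation.Integers.mem_of_integral
      (Valuation.integer.integers _) h2
    rw [map_inv₀, hvp, ← exp_neg, ← exp_zero, exp_le_exp] at h3
    omega

/-- Otherwise both terms of `π = π² p + q f(σ⁻¹, σ)` would lie in `M²`, contradicting that `π` is
still a uniformizer at `M`. Only left ideals are needed. -/
theorem val_inv_self_notMem_sq {V F K : Type*} [CommRing V] [IsDomain V]
    [IsDiscreteValuationRing V] [Field F] [Algebra V F] [IsFractionRing V F]
    [Field K] [Algebra F K] [FiniteDimensional F K] [IsGalois F K]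
    [Algebra V K] [IsScalarTower V F K]
    [Algebra.FormallyUnramified V (integralClosure V K)]
    (f : NormalizedCocycle Gal(K/F) K)
    (hf : ∀ σ τ, f.val σ τ ∈ integralClosure V K) (hA : IsHereditaryRing (orderA f hf))
    (M : Ideal (integralClosure V K)) [M.IsMaximal] (σ : Gal(K/F)) :
    (⟨f.val σ⁻¹ σ, hf _ _⟩ : integralClosure V K) ∉ M ^ 2 := by
  obtain ⟨π, hπ⟩ := IsDiscreteValuationRing.exists_irreducible V
  obtain ⟨p, hp, q, hq, h⟩ := exists_eq_sq_mul_add_of_projective f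
    (integralClosure V K).toSubring _ hf hA.1 σ
    (π := algebraMap V K π) (algebraMap V (integralClosure V K) π).2 fun τ => by
      change τ (algebraMap V K π) = algebraMap V K π
      rw [IsScalarTower.algebraMap_apply V F K, AlgEquiv.commutes]
  intro hM
  apply algebraMap_notMem_sq F M hπ
  have h' : algebraMap V (integralClosure V K) π =
      algebraMap V (integralClosure V K) π ^ 2 * ⟨p, hp⟩ + ⟨q, hq⟩ * ⟨f.val σ⁻¹ σ, hf _ _⟩ :=
    Subtype.ext h
  rw [h']
  exact add_mem (Ideal.mul_mem_right _ _
    (Ideal.pow_mem_pow (algebraMap_mem_of_isMaximal F M hπ) 2)) (Ideal.mul_mem_left _ _ hM)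

end CrossedOrder

theorem corollary5 {V F K : Type*} [CommRing V] [IsDomain V] [IsDiscreteValuationRing V]
    [Field F] [Algebra V F] [IsFractionRing V F]
    [Field K] [Algebra F K] [FiniteDimensional F K] [IsGalois F K]
    [Algebra V K] [IsScalarTower V F K]
    [Algebra.FormallyUnramified V (integralClosure V K)]
    (f : CrossedOrder.NormalizedCocycle Gal(K/F) K)
    (hf : ∀ σ τ, f.val σ τ ∈ integralClosure V K)
    (hA : CrossedOrder.IsHereditaryRing (CrossedOrder.orderA f hf))
    (M : Ideal (integralClosure V K)) [M.IsMaximal] :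
    CrossedOrder.IsMaximalOrder (CrossedOrder.localBase F M) (CrossedOrder.decompositionField F M)
      (CrossedOrder.localOrderA f hf M) :=
  CrossedOrder.isMaximalOrder_localOrderA f hf M fun σ _ =>
    CrossedOrder.val_inv_self_notMem_sq f hf hA M σ
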